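/- Let $\Omega\subset\mathbb{R}^2$ be a bounded open set (for instance a bounded polygonal domain) with boundary $\Gamma$. All functions are real-valued, and $(\cdot,\cdot)_\Omega$ is the inner product of $L^2(\Omega)$ or $L^2(\Omega)^2$. $H^1(\Omega)$ is the space of functions in $L^2(\Omega)$ with weak gradient in $L^2(\Omega)^2$, $H^1_0(\Omega)$ is the closure of $C_c^\infty(\Omega)$ in $H^1(\Omega)$, and the trace space is $H^{1/2}(\Gamma):=H^1(\Omega)/H^1_0(\Omega)$; the class of $\chi\in H^1(\Omega)$ is its trace $\chi|_\Gamma$, and $(\cdot,\cdot)_\Gamma$ denotes the duality pairings on $\Gamma$, with $(\zeta,\chi)_\Gamma:=(\zeta,\chi|_\Gamma)_\Gamma$. Let $H^1_\Delta(\Omega)=\{v\in H^1(\Omega):\Delta v\in L^2(\Omega)\}$ with the distributional Laplacian $\Delta$. The normal derivative $\partial_n v\in H^{1/2}(\Gamma)'$ of $v\in H^1_\Delta(\Omega)$ is the functional given by $$(\partial_n v,\chi)_\Gamma=(\nabla v,\nabla\chi)_\Omega+(\Delta v,\chi)_\Omega\qquad\forall\chi\in H^1(\Omega).$$ Put $$V:=H^1_0(\Omega)\cap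 H^1_\Delta(\Omega),\quad \|v\|_V:=\|\Delta v\|_{L^2(\Omega)},\qquad V_\Gamma:=\{\partial_n v:v\in V\},\quad \|\zeta\|_{V_\Gamma}:=\inf\{\|v\|_V: v\in V,\ \partial_n v=\zeta\},$$ and let $V'$, $V_\Gamma'$ be the dual spaces. For $\varphi\in L^2(\Omega)$ consider the following problem for $(v,\zeta)\in V\times V_\Gamma$, consisting of a weak Poisson problem and a Green-formula identity: $$(\nabla v,\nabla\psi)_\Omega=(\varphi,\psi)_\Omega\quad\forall\psi\in H^1_0(\Omega),\tag{1}$$ $$(\zeta,\chi)_\Gamma=(\nabla v,\nabla\chi)_\Omega-(\varphi,\chi)_\Omega\quad\forall\chi\in H^1(\Omega)\setminus H^1_0(\Omega).\tag{2}$$ Then: (a) For every $\varphi\in L^2(\Omega)$ there is exactly one pair $(v,\zeta)\in V\times V_\Gamma$ that satisfies (1) and (2). (b) For all $\varphi\in L^2(\Omega)$, $v\in V$ and $\zeta\in V_\Gamma$, (1) and (2) hold if and only if $\varphi=-\Delta v$ and $\zeta=\partial_n v$. (c) For all $f\in V'$, $u\in V_\Gamma'$ and $y\in L^2(\Omega)$,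 Berggren's formulation $$(y,\varphi)_\Omega=-(u,\zeta)_\Gamma+(f,v)_\Omega\quad\forall\varphi\in L^2(\Omega),\ \text{where } (v,\zeta)\in V\times V_\Gamma \text{ solves (1), (2)},$$ holds if and only if $y$ satisfies the very weak formulation $$(y,\Delta v)_\Omega=(u,\partial_n v)_\Gamma-(f,v)_\Omega\quad\forall v\in V.$$ -/

import Mathlib

open MeasureTheory TopologicalSpace
open scoped Distributions ContDiff

noncomputable section

namespace VeryWeak

/-- The Euclidean plane `ℝ²`. -/
abbrev Plane : Type := EuclideanSpace ℝ (Fin 2)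

/-- `L²(Ω)`, with inner product `(w, v)_Ω = ∫_Ω w v`. -/
abbrev L2 (Ω : Opens Plane) : Type := Lp ℝ 2 (volume.restrict (Ω : Set Plane))

/-- `L²(Ω)²`, with inner product `∫_Ω g · h`. -/
abbrev L2Vec (Ω : Opens Plane) : Type := Lp Plane 2 (volume.restrict (Ω : Set Plane))

/-! ### Test functions as elements of `L²` -/

lemma memLp_test (Ω : Opens Plane) (η : 𝓓(Ω, ℝ)) :
    MemLp (η : Plane → ℝ) 2 (volume.restrict (Ω : Set Plane)) :=
  η.continuous.memLp_of_hasCompactSupport η.hasCompactSupport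

lemma contDiff_infty (Ω : Opens Plane) (η : 𝓓(Ω, ℝ)) : ContDiff ℝ ∞ (η : Plane → ℝ) :=
  η.contDiff

/-- The partial derivative `∂_e η` of a test function, again a test function. -/
def partialTest {Ω : Opens Plane} (η : 𝓓(Ω, ℝ)) (e : Plane) : 𝓓(Ω, ℝ) where
  toFun x := fderiv ℝ η x e
  contDiff' := ((contDiff_infty Ω η).fderiv_right (m := ∞) (by simp)).clm_apply contDiff_const
  hasCompactSupport' := η.hasCompactSupport.fderiv_apply (𝕜 := ℝ) e
  tsupport_subset' := (tsupport_fderiv_apply_subset ℝ e).trans η.tsupport_subset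

@[simp]
lemma partialTest_apply {Ω : Opens Plane} (η : 𝓓(Ω, ℝ)) (e x : Plane) :
    partialTest η e x = fderiv ℝ η x e := rfl

lemma inner_toLp {Ω : Opens Plane} (v : L2 Ω) (η : 𝓓(Ω, ℝ)) :
    inner ℝ v (memLp_test Ω η).toLp = ∫ x in (Ω : Set Plane), v x * η x := by
  rw [L2.inner_def]
  refine integral_congr_ae ?_
  filter_upwards [(memLp_test Ω η).coeFn_toLp] with x hx
  simp [hx, mul_comm]

lemma memLp_gradient (Ω : Opens Plane) (η : 𝓓(Ω, ℝ)) :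
    MemLp (gradient (η : Plane → ℝ)) 2 (volume.restrict (Ω : Set Plane)) := by
  have h1 : Continuous (fderiv ℝ (η : Plane → ℝ)) :=
    (contDiff_infty Ω η).continuous_fderiv (by simp)
  have h2 : HasCompactSupport (fderiv ℝ (η : Plane → ℝ)) := η.hasCompactSupport.fderiv ℝ
  refine Continuous.memLp_of_hasCompactSupport
    ((InnerProductSpace.toDual ℝ Plane).symm.continuous.comp h1) ?_
  exact h2.comp_left (g := (InnerProductSpace.toDual ℝ Plane).symm) (by simp)

/-! ### Weak derivatives -/

/-- `g` is the weak gradient of `v` in `Ω`: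
`∫_Ω v ∂_e η = - ∫_Ω (g · e) η` for all test functions `η` and all directions `e`. -/
def IsWeakGradient {Ω : Opens Plane} (v : L2 Ω) (g : L2Vec Ω) : Prop :=
  ∀ (η : 𝓓(Ω, ℝ)) (e : Plane),
    ∫ x in (Ω : Set Plane), v x * fderiv ℝ η x e =
      -∫ x in (Ω : Set Plane), inner ℝ (g x) e * η x

/-- `w` is the distributional Laplacian of `v` in `Ω`:
`∫_Ω v Δη = ∫_Ω w η` for all test functions `η`. -/
def IsWeakLaplacian {Ω : Opens Plane} (v w : L2 Ω) : Prop :=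
  ∀ η : 𝓓(Ω, ℝ),
    ∫ x in (Ω : Set Plane), v x * Laplacian.laplacian (η : Plane → ℝ) x =
      ∫ x in (Ω : Set Plane), w x * η x

/-- The Laplacian of a test function, again a test function. -/
def lapTest {Ω : Opens Plane} (η : 𝓓(Ω, ℝ)) : 𝓓(Ω, ℝ) :=
  ∑ i, partialTest (partialTest η (EuclideanSpace.basisFun (Fin 2) ℝ i))
    (EuclideanSpace.basisFun (Fin 2) ℝ i)

lemma laplacian_eq_lapTest {Ω : Opens Plane} (η : 𝓓(Ω, ℝ)) (x : Plane) :
    Laplacian.laplacian (η : Plane → ℝ) x = lapTest η x := by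
  rw [InnerProductSpace.laplacian_eq_iteratedFDeriv_orthonormalBasis (η : Plane → ℝ)
    (EuclideanSpace.basisFun (Fin 2) ℝ)]
  have hd : DifferentiableAt ℝ (fderiv ℝ (η : Plane → ℝ)) x :=
    (((contDiff_infty Ω η).fderiv_right (m := ∞) (by simp)).differentiable (by simp)) x
  have key : ∀ e : Plane, fderiv ℝ (fun z => fderiv ℝ (η : Plane → ℝ) z e) x e =
      iteratedFDeriv ℝ 2 (η : Plane → ℝ) x ![e, e] := by
    intro e
    rw [iteratedFDeriv_two_apply, fderiv_clm_apply hd (by fun_prop)]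
    simp
  simp only [lapTest, Fin.sum_univ_two]
  rw [← key, ← key]
  rfl

lemma isWeakLaplacian_iff {Ω : Opens Plane} (v w : L2 Ω) :
    IsWeakLaplacian v w ↔ ∀ η : 𝓓(Ω, ℝ),
      inner ℝ v (memLp_test Ω (lapTest η)).toLp = inner ℝ w (memLp_test Ω η).toLp := by
  simp only [IsWeakLaplacian, inner_toLp, laplacian_eq_lapTest]

lemma memLp_smul_test {Ω : Opens Plane} (η : 𝓓(Ω, ℝ)) (e : Plane) :
    MemLp (fun x => η x • e) 2 (volume.restrict (Ω : Set Plane)) :=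
  (η.continuous.smul continuous_const).memLp_of_hasCompactSupport
    (η.hasCompactSupport.smul_right (f' := fun _ => e))

lemma isWeakGradient_iff {Ω : Opens Plane} (v : L2 Ω) (g : L2Vec Ω) :
    IsWeakGradient v g ↔ ∀ (η : 𝓓(Ω, ℝ)) (e : Plane),
      inner ℝ v (memLp_test Ω (partialTest η e)).toLp =
        -inner ℝ g (memLp_smul_test η e).toLp := by
  have h : ∀ (η : 𝓓(Ω, ℝ)) (e : Plane), inner ℝ g (memLp_smul_test η e).toLp =
      ∫ x in (Ω : Set Plane), inner ℝ (g x) e * η x := by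
    intro η e
    rw [L2.inner_def]
    refine integral_congr_ae ?_
    filter_upwards [(memLp_smul_test η e).coeFn_toLp] with x hx
    rw [hx, real_inner_smul_right, mul_comm]
  simp only [IsWeakGradient, inner_toLp, h, partialTest_apply]

lemma isWeakLaplacian_unique {Ω : Opens Plane} {v w w' : L2 Ω}
    (h : IsWeakLaplacian v w) (h' : IsWeakLaplacian v w') : w = w' := by
  rw [isWeakLaplacian_iff] at h h'
  rw [← sub_eq_zero]
  have hli : LocallyIntegrableOn (w - w' : L2 Ω) (Ω : Set Plane) volume :=
    locallyIntegrableOn_of_locallyIntegrable_restrict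
      ((Lp.memLp (w - w')).locallyIntegrable (by norm_num))
  have hz := Ω.isOpen.ae_eq_zero_of_integral_contDiff_smul_eq_zero hli (fun g hg hc hs => by
    let η : 𝓓(Ω, ℝ) := ⟨g, hg, hc, hs⟩
    have h0 : inner ℝ (w - w') (memLp_test Ω η).toLp = 0 := by
      rw [inner_sub_left, ← h η, ← h' η, sub_self]
    rw [inner_toLp] at h0
    rw [← setIntegral_eq_integral_of_forall_compl_eq_zero (s := (Ω : Set Plane)), ← h0]
    · exact integral_congr_ae (Filter.Eventually.of_forall fun x => mul_comm _ _)
    · intro x hx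
      have : g x = 0 := image_eq_zero_of_notMem_tsupport fun hx' => hx (hs hx')
      simp [this])
  rw [Lp.eq_zero_iff_ae_eq_zero]
  exact (ae_restrict_iff' Ω.isOpen.measurableSet).2 hz

/-! ### The spaces `H¹(Ω)`, `H¹₀(Ω)` and the trace space -/

/-- `H¹(Ω)`: the pairs `(v, ∇v)` of an `L²` function and its (unique) weak gradient in `L²`,
with the inner product `(v, w)_Ω + (∇v, ∇w)_Ω`. -/
def H1 (Ω : Opens Plane) : Submodule ℝ (WithLp 2 (L2 Ω × L2Vec Ω)) where
  carrier := {p | IsWeakGradient p.fst p.snd}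
  zero_mem' := by simp [isWeakGradient_iff]
  add_mem' := by
    intro p q hp hq
    simp only [Set.mem_ofPred_eq, isWeakGradient_iff] at *
    intro η e
    simp only [WithLp.add_fst, WithLp.add_snd, inner_add_left, hp η e, hq η e]
    ring
  smul_mem' := by
    intro c p hp
    simp only [Set.mem_ofPred_eq, isWeakGradient_iff] at *
    intro η e
    simp only [WithLp.smul_fst, WithLp.smul_snd, real_inner_smul_left, hp η e]
    ring

/-- The embedding `H¹(Ω) → L²(Ω)`. -/
def val {Ω : Opens Plane} : H1 Ω →L[ℝ] L2 Ω :=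
  (WithLp.fstL 2 ℝ (L2 Ω) (L2Vec Ω)).comp (H1 Ω).subtypeL

/-- The weak gradient `∇ : H¹(Ω) → L²(Ω)²`. -/
def grad {Ω : Opens Plane} : H1 Ω →L[ℝ] L2Vec Ω :=
  (WithLp.sndL 2 ℝ (L2 Ω) (L2Vec Ω)).comp (H1 Ω).subtypeL

lemma isWeakGradient_grad {Ω : Opens Plane} (v : H1 Ω) : IsWeakGradient (val v) (grad v) :=
  v.2

lemma isWeakGradient_test {Ω : Opens Plane} (η : 𝓓(Ω, ℝ)) :
    IsWeakGradient (memLp_test Ω η).toLp (memLp_gradient Ω η).toLp := by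
  intro θ e
  have hη : ∀ (ψ : 𝓓(Ω, ℝ)) (x : Plane), x ∉ (Ω : Set Plane) → ψ x = 0 := fun ψ x hx =>
    image_eq_zero_of_notMem_tsupport fun hx' => hx (ψ.tsupport_subset hx')
  have hi : ∀ ψ χ : 𝓓(Ω, ℝ), Integrable (fun x => ψ x * χ x) volume := fun ψ χ =>
    (ψ.continuous.mul χ.continuous).integrable_of_hasCompactSupport
      (ψ.hasCompactSupport.mul_right)
  have hL : ∫ x in (Ω : Set Plane), ((memLp_test Ω η).toLp : L2 Ω) x * fderiv ℝ θ x e =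
      ∫ x, η x * fderiv ℝ θ x e := by
    rw [← setIntegral_eq_integral_of_forall_compl_eq_zero (s := (Ω : Set Plane))
      (f := fun x => η x * fderiv ℝ θ x e)
      (fun x hx => by simp [hη η x hx])]
    refine integral_congr_ae ?_
    filter_upwards [(memLp_test Ω η).coeFn_toLp] with x hx
    rw [hx]
  have hR : ∫ x in (Ω : Set Plane), inner ℝ (((memLp_gradient Ω η).toLp : L2Vec Ω) x) e * θ x =
      ∫ x, fderiv ℝ η x e * θ x := by
    rw [← setIntegral_eq_integral_of_forall_compl_eq_zero (s := (Ω : Set Plane))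
      (f := fun x => fderiv ℝ η x e * θ x)
      (fun x hx => by simp [hη θ x hx])]
    refine integral_congr_ae ?_
    filter_upwards [(memLp_gradient Ω η).coeFn_toLp] with x hx
    rw [hx, inner_gradient_left]
  rw [hL, hR]
  exact integral_mul_fderiv_eq_neg_fderiv_mul_of_integrable (hi (partialTest η e) θ)
    (hi η (partialTest θ e)) (hi η θ)
    (fun x _ => (contDiff_infty Ω η).differentiable (by simp) x)
    (fun x _ => (contDiff_infty Ω θ).differentiable (by simp) x)

/-- A test function as an element of `H¹(Ω)`. -/
def testH1 (Ω : Opens Plane) (η : 𝓓(Ω, ℝ)) : H1 Ω :=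
  ⟨WithLp.toLp 2 ((memLp_test Ω η).toLp, (memLp_gradient Ω η).toLp), isWeakGradient_test η⟩

/-- `H¹₀(Ω)`: the closure in `H¹(Ω)` of the test functions on `Ω`. -/
def H10 (Ω : Opens Plane) : Submodule ℝ (H1 Ω) :=
  (Submodule.span ℝ (Set.range (testH1 Ω))).topologicalClosure

/-- The trace space `H^{1/2}(Γ)`, `Γ = ∂Ω`: functions in `H¹(Ω)` up to functions in `H¹₀(Ω)`,
with the quotient norm. -/
abbrev TraceSpace (Ω : Opens Plane) : Type := H1 Ω ⧸ H10 Ω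

/-- The trace `χ ↦ χ|_Γ`. -/
def trace {Ω : Opens Plane} : H1 Ω →ₗ[ℝ] TraceSpace Ω := (H10 Ω).mkQ

/-! ### The maximal domain of the Laplacian and the normal derivative -/

/-- `H¹_Δ(Ω) = {v ∈ H¹(Ω) : Δv ∈ L²(Ω)}`. -/
def H1Lap (Ω : Opens Plane) : Submodule ℝ (H1 Ω) where
  carrier := {v | ∃ w : L2 Ω, IsWeakLaplacian (val v) w}
  zero_mem' := ⟨0, by simp [isWeakLaplacian_iff]⟩
  add_mem' := by
    rintro v v' ⟨w, hw⟩ ⟨w', hw'⟩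
    refine ⟨w + w', ?_⟩
    rw [isWeakLaplacian_iff] at *
    intro η
    rw [map_add, inner_add_left, inner_add_left, hw, hw']
  smul_mem' := by
    rintro c v ⟨w, hw⟩
    refine ⟨c • w, ?_⟩
    rw [isWeakLaplacian_iff] at *
    intro η
    rw [map_smul, real_inner_smul_left, real_inner_smul_left, hw]

lemma isWeakLaplacian_choose {Ω : Opens Plane} (v : H1Lap Ω) :
    IsWeakLaplacian (val (v : H1 Ω)) v.2.choose := v.2.choose_spec

/-- The Laplacian `Δ : H¹_Δ(Ω) → L²(Ω)`. -/
def lap {Ω : Opens Plane} : H1Lap Ω →ₗ[ℝ] L2 Ω where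
  toFun v := v.2.choose
  map_add' v v' := by
    refine isWeakLaplacian_unique (isWeakLaplacian_choose (v + v')) ?_
    have h := isWeakLaplacian_choose v
    have h' := isWeakLaplacian_choose v'
    rw [isWeakLaplacian_iff] at *
    intro η
    rw [Submodule.coe_add, map_add, inner_add_left, inner_add_left, h, h']
  map_smul' c v := by
    refine isWeakLaplacian_unique (isWeakLaplacian_choose (c • v)) ?_
    have h := isWeakLaplacian_choose v
    rw [isWeakLaplacian_iff] at *
    intro η
    rw [Submodule.coe_smul, map_smul, real_inner_smul_left, RingHom.id_apply,
      real_inner_smul_left, h]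

lemma isWeakLaplacian_lap {Ω : Opens Plane} (v : H1Lap Ω) :
    IsWeakLaplacian (val (v : H1 Ω)) (lap v) := isWeakLaplacian_choose v

/-- The functional `χ ↦ (∇v, ∇χ)_Ω + (Δv, χ)_Ω` on `H¹(Ω)`. -/
def greenFunctional {Ω : Opens Plane} (v : H1Lap Ω) : StrongDual ℝ (H1 Ω) :=
  (innerSL ℝ (grad (v : H1 Ω))).comp grad + (innerSL ℝ (lap v)).comp val

lemma greenFunctional_apply {Ω : Opens Plane} (v : H1Lap Ω) (χ : H1 Ω) :
    greenFunctional v χ =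
      inner ℝ (grad (v : H1 Ω)) (grad χ) + inner ℝ (lap v) (val χ) := rfl

lemma greenFunctional_test {Ω : Opens Plane} (v : H1Lap Ω) (η : 𝓓(Ω, ℝ)) :
    greenFunctional v (testH1 Ω η) = 0 := by
  have hg := (isWeakGradient_iff _ _).1 (isWeakGradient_grad (v : H1 Ω))
  have hl := (isWeakLaplacian_iff _ _).1 (isWeakLaplacian_lap v) η
  let b := EuclideanSpace.basisFun (Fin 2) ℝ
  have e1 : (memLp_test Ω (lapTest η)).toLp =
      ∑ i, (memLp_test Ω (partialTest (partialTest η (b i)) (b i))).toLp := by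
    rw [Fin.sum_univ_two, ← MemLp.toLp_add]
    refine MemLp.toLp_congr _ _ (Filter.Eventually.of_forall fun x => ?_)
    simp only [lapTest, Fin.sum_univ_two]
    rfl
  have e2 : (memLp_gradient Ω η).toLp = ∑ i, (memLp_smul_test (partialTest η (b i)) (b i)).toLp := by
    rw [Fin.sum_univ_two, ← MemLp.toLp_add]
    refine MemLp.toLp_congr _ _ (Filter.Eventually.of_forall fun x => ?_)
    have := b.sum_repr' (gradient (η : Plane → ℝ) x)
    rw [Fin.sum_univ_two, real_inner_comm, inner_gradient_left, real_inner_comm,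
      inner_gradient_left] at this
    exact this.symm
  have t1 : grad (testH1 Ω η) = (memLp_gradient Ω η).toLp := rfl
  have t2 : val (testH1 Ω η) = (memLp_test Ω η).toLp := rfl
  rw [greenFunctional_apply, t1, t2, ← hl, e1, e2, inner_sum, inner_sum, ← Finset.sum_add_distrib]
  refine Finset.sum_eq_zero fun i _ => ?_
  rw [hg, add_neg_cancel]

lemma H10_le_ker {Ω : Opens Plane} (v : H1Lap Ω) : H10 Ω ≤ (greenFunctional v).ker := by
  refine Submodule.topologicalClosure_minimal _ ?_ (greenFunctional v).isClosed_ker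
  rw [Submodule.span_le]
  rintro _ ⟨η, rfl⟩
  exact greenFunctional_test v η

/-- The normal derivative `∂_n v ∈ H^{-1/2}(Γ) = H^{1/2}(Γ)'` of `v ∈ H¹_Δ(Ω)`,
`(∂_n v, χ|_Γ)_Γ = (∇v, ∇χ)_Ω + (Δv, χ)_Ω` for `χ ∈ H¹(Ω)`. -/
def normalDeriv {Ω : Opens Plane} : H1Lap Ω →ₗ[ℝ] StrongDual ℝ (TraceSpace Ω) where
  toFun v := (H10 Ω).liftQL (greenFunctional v) (H10_le_ker v)
  map_add' v v' := by
    ext x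
    obtain ⟨χ, rfl⟩ := (H10 Ω).mkQ_surjective x
    simp [greenFunctional_apply, inner_add_left]
    ring
  map_smul' c v := by
    ext x
    obtain ⟨χ, rfl⟩ := (H10 Ω).mkQ_surjective x
    simp [greenFunctional_apply, real_inner_smul_left]
    ring

lemma normalDeriv_trace {Ω : Opens Plane} (v : H1Lap Ω) (χ : H1 Ω) :
    normalDeriv v (trace χ) =
      inner ℝ (grad (v : H1 Ω)) (grad χ) + inner ℝ (lap v) (val χ) := rfl

/-! ### The test space `V`, the space `V_Γ` and their duals -/

/-- `V = H¹₀(Ω) ∩ H¹_Δ(Ω)`. -/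
def V (Ω : Opens Plane) : Submodule ℝ (H1 Ω) := H10 Ω ⊓ H1Lap Ω

/-- The inclusion `V → H¹_Δ(Ω)`. -/
def V.toH1Lap {Ω : Opens Plane} : V Ω →ₗ[ℝ] H1Lap Ω := Submodule.inclusion inf_le_right

/-- The Laplacian `Δ : V → L²(Ω)`. -/
def lapV {Ω : Opens Plane} : V Ω →ₗ[ℝ] L2 Ω := lap ∘ₗ V.toH1Lap

/-- `‖v‖_V = ‖Δv‖_{L²(Ω)}`. -/
def normV {Ω : Opens Plane} (v : V Ω) : ℝ := ‖lapV v‖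

/-- `V_Γ`: the space of the normal derivatives `∂_n v` of the functions `v ∈ V`. -/
def VΓ (Ω : Opens Plane) : Submodule ℝ (StrongDual ℝ (TraceSpace Ω)) :=
  LinearMap.range (normalDeriv ∘ₗ (V.toH1Lap (Ω := Ω)))

/-- The normal derivative `∂_n : V → V_Γ`. -/
def normalDerivV {Ω : Opens Plane} : V Ω →ₗ[ℝ] VΓ Ω :=
  LinearMap.rangeRestrict (normalDeriv ∘ₗ V.toH1Lap)

/-- `‖ζ‖_{V_Γ} = inf {‖v‖_V : v ∈ V, ∂_n v = ζ}`. -/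
def normVΓ {Ω : Opens Plane} (ζ : VΓ Ω) : ℝ := sInf (normV '' {v : V Ω | normalDerivV v = ζ})

/-- `V'`: the linear functionals on `V` that are bounded with respect to `‖·‖_V`. -/
def DualV (Ω : Opens Plane) : Type :=
  {f : V Ω →ₗ[ℝ] ℝ // ∃ C : ℝ, ∀ v, |f v| ≤ C * normV v}

/-- `V_Γ'`: the linear functionals on `V_Γ` that are bounded with respect to `‖·‖_{V_Γ}`. -/
def DualVΓ (Ω : Opens Plane) : Type :=
  {u : VΓ Ω →ₗ[ℝ] ℝ // ∃ C : ℝ, ∀ ζ, |u ζ| ≤ C * normVΓ ζ}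

/-! ### The two formulations -/

/-- The very weak formulation:
`(y, Δv)_Ω = (u, ∂_n v)_Γ - (f, v)_Ω` for all `v ∈ V`. -/
def IsVeryWeakSolution {Ω : Opens Plane} (f : DualV Ω) (u : DualVΓ Ω) (y : L2 Ω) : Prop :=
  ∀ v : V Ω, inner ℝ y (lapV v) = u.1 (normalDerivV v) - f.1 v

/-- The weak Poisson problem for `v ∈ V`:
`(∇v, ∇ψ)_Ω = (φ, ψ)_Ω` for all `ψ ∈ H¹₀(Ω)`. -/
def SolvesPoisson {Ω : Opens Plane} (φ : L2 Ω) (v : V Ω) : Prop :=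
  ∀ ψ ∈ H10 Ω, inner ℝ (grad (v : H1 Ω)) (grad ψ) = inner ℝ φ (val ψ)

/-- The Green identity for `ζ ∈ V_Γ`:
`(ζ, χ)_Γ = (∇v, ∇χ)_Ω - (φ, χ)_Ω` for all `χ ∈ H¹(Ω) \ H¹₀(Ω)`. -/
def SolvesGreen {Ω : Opens Plane} (φ : L2 Ω) (v : V Ω) (ζ : VΓ Ω) : Prop :=
  ∀ χ : H1 Ω, χ ∉ H10 Ω →
    (ζ : StrongDual ℝ (TraceSpace Ω)) (trace χ) =
      inner ℝ (grad (v : H1 Ω)) (grad χ) - inner ℝ φ (val χ)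

/-- Berggren's formulation: for every `φ ∈ L²(Ω)` there are `v ∈ V` and `ζ ∈ V_Γ` that solve the
weak Poisson problem and the Green identity and satisfy `(y, φ)_Ω = -(u, ζ)_Γ + (f, v)_Ω`. -/
def IsBerggrenSolution {Ω : Opens Plane} (f : DualV Ω) (u : DualVΓ Ω) (y : L2 Ω) : Prop :=
  ∀ φ : L2 Ω, ∃ (v : V Ω) (ζ : VΓ Ω), SolvesPoisson φ v ∧ SolvesGreen φ v ζ ∧
    inner ℝ y φ = -u.1 ζ + f.1 v

end VeryWeak

end

/-!
Everything rests on two facts about a bounded open set `Ω`.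

* The Poincaré inequality `‖v‖ ≤ C ‖∇v‖` on `H¹₀(Ω)`. For a test function `η`, integrating
  `∫ (∂₀x₀) η²` by parts gives `∫ η² = -2 ∫ x₀ η ∂₀η`, and `x₀` is bounded on `Ω`; the inequality
  passes to the closure (`exists_norm_val_le_norm_grad`).
* The integration by parts `(∇v, ∇η) = -(v, Δη)` for `v ∈ H¹(Ω)` and test functions `η`
  (`inner_grad_testH1`).

By the Poincaré inequality the Dirichlet form is coercive on the Hilbert space `H¹₀(Ω)`, so the
Lax–Milgram theorem solves the weak Poisson problem, and by the second fact the solution has the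
Laplacian `-φ ∈ L²(Ω)`, hence lies in `V`. Conversely, testing the Poisson problem for `v ∈ V`
with test functions gives `φ = -Δv`, and the Green identity then says `ζ(χ|_Γ) = (∂_n v, χ)_Γ`
for `χ ∉ H¹₀(Ω)`; for `χ ∈ H¹₀(Ω)` both sides vanish, so `ζ = ∂_n v`. Thus `(v, ζ)` solves the
problem for `φ` exactly when `φ = -Δv` and `ζ = ∂_n v`. As `Δ : V → L²(Ω)` is a bijection, the
pair is unique, and Berggren's formulation becomes the very weak one under `φ = -Δv`.
-/

open MeasureTheory TopologicalSpace
open scoped Distributions ContDiff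

namespace VeryWeak

variable {Ω : Opens Plane}

/-! ### Completeness -/

lemma isClosed_H1 (Ω : Opens Plane) :
    IsClosed (H1 Ω : Set (WithLp 2 (L2 Ω × L2Vec Ω))) := by
  have h : (H1 Ω : Set (WithLp 2 (L2 Ω × L2Vec Ω))) =
      ⋂ (η : 𝓓(Ω, ℝ)) (e : Plane), {p | inner ℝ p.fst (memLp_test Ω (partialTest η e)).toLp =
        -inner ℝ p.snd (memLp_smul_test η e).toLp} := by
    ext p
    simp only [Set.mem_iInter]
    exact isWeakGradient_iff p.fst p.snd
  rw [h]
  refine isClosed_iInter fun η => isClosed_iInter fun e => isClosed_eq ?_ ?_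
  · exact (WithLp.fstL 2 ℝ (L2 Ω) (L2Vec Ω)).continuous.inner continuous_const
  · exact ((WithLp.sndL 2 ℝ (L2 Ω) (L2Vec Ω)).continuous.inner continuous_const).neg

instance completeSpace_H1 (Ω : Opens Plane) : CompleteSpace (H1 Ω) :=
  (isClosed_H1 Ω).completeSpace_coe

instance completeSpace_H10 (Ω : Opens Plane) : CompleteSpace (H10 Ω) :=
  (Submodule.isClosed_topologicalClosure _).completeSpace_coe

lemma norm_sq_eq_val_add_grad (v : H1 Ω) : ‖v‖ ^ 2 = ‖val v‖ ^ 2 + ‖grad v‖ ^ 2 :=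
  WithLp.prod_norm_sq_eq_of_L2 (v : WithLp 2 (L2 Ω × L2Vec Ω))

/-! ### The Poincaré inequality -/

/-- Integration by parts of `∫ η² = ∫ (∂₀x₀) η²`, where `x₀` is the first coordinate. -/
lemma integral_sq_eq_neg_two_mul (η : 𝓓(Ω, ℝ)) :
    ∫ x, η x * η x = -(2 * ∫ x : Plane,
      η x * (x 0 * fderiv ℝ η x (EuclideanSpace.single 0 1))) := by
  set e : Plane := EuclideanSpace.single 0 1 with he
  let L : Plane →L[ℝ] ℝ := EuclideanSpace.proj 0
  have hLx : ∀ x : Plane, L x = x 0 := fun _ => rfl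
  have hLe : L e = 1 := by simp [hLx, he]
  have hd : ∀ x, DifferentiableAt ℝ (η : Plane → ℝ) x :=
    fun x => (contDiff_infty Ω η).differentiable (by simp) x
  have hsq : ∀ x, fderiv ℝ (fun x => η x * η x) x e = 2 * (η x * partialTest η e x) := by
    intro x
    rw [fderiv_fun_mul (hd x) (hd x)]
    simp
    ring
  have hint : ∀ g : Plane → ℝ, Continuous g → Integrable (fun x => η x * g x) volume :=
    fun g hg => (η.continuous.mul hg).integrable_of_hasCompactSupport η.hasCompactSupport.mul_right
  have hcont := (partialTest η e).continuous
  have key := integral_mul_fderiv_eq_neg_fderiv_mul_of_integrable (μ := volume)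
    (f := fun x => L x) (g := fun x => η x * η x) (v := e)
    ?_ ?_ ?_ (fun x _ => L.differentiableAt) (fun x _ => (hd x).mul (hd x))
  · have h1 : ∀ x, fderiv ℝ (fun x => L x) x e = 1 := fun x => by
      rw [show (fun x => L x) = L from rfl, L.fderiv, hLe]
    simp only [h1, one_mul, hsq] at key
    rw [← integral_const_mul, eq_comm, neg_eq_iff_eq_neg, ← key]
    refine integral_congr_ae (Filter.Eventually.of_forall fun x => ?_)
    simp only [hLx, partialTest_apply]
    ring
  · simp only [show (fun x => L x) = L from rfl, L.fderiv, hLe, one_mul]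
    exact hint _ η.continuous
  · simp only [hsq]
    refine (hint (fun x => 2 * (L x * partialTest η e x)) (by fun_prop)).congr
      (Filter.Eventually.of_forall fun x => ?_)
    simp only
    ring
  · refine (hint (fun x => L x * η x) (by fun_prop)).congr
      (Filter.Eventually.of_forall fun x => ?_)
    simp only
    ring

lemma norm_val_testH1_le {R : ℝ} (hR : ∀ x ∈ Ω, ‖x‖ ≤ R) (η : 𝓓(Ω, ℝ)) :
    ‖val (testH1 Ω η)‖ ≤ 2 * R * ‖grad (testH1 Ω η)‖ := by
  set e : Plane := EuclideanSpace.single 0 1 with he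
  have he1 : ‖e‖ = 1 := by simp [he]
  have hη : ∀ x, x ∉ (Ω : Set Plane) → η x = 0 := fun x hx =>
    image_eq_zero_of_notMem_tsupport fun hx' => hx (η.tsupport_subset hx')
  have hv : ((val (testH1 Ω η) : L2 Ω) : Plane → ℝ) =ᵐ[volume.restrict (Ω : Set Plane)] η :=
    (memLp_test Ω η).coeFn_toLp
  -- The function `x₀ ∂₀η` has norm at most `R ‖∇η‖`, since `|x₀| ≤ R` on `Ω`.
  have hm : MemLp (fun x : Plane => x 0 * fderiv ℝ η x e) 2 (volume.restrict (Ω : Set Plane)) := by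
    refine Continuous.memLp_of_hasCompactSupport ?_
      ((partialTest η e).hasCompactSupport.mul_left (f := fun x : Plane => x 0))
    have := (partialTest η e).continuous
    exact Continuous.mul (by fun_prop) this
  have hle : ‖(hm.toLp : L2 Ω)‖ ≤ R * ‖grad (testH1 Ω η)‖ := by
    refine Lp.norm_le_mul_norm_of_ae_le_mul ?_
    filter_upwards [hm.coeFn_toLp, (memLp_gradient Ω η).coeFn_toLp,
      ae_restrict_mem Ω.isOpen.measurableSet] with x h1 h2 hx
    have h3 : ((grad (testH1 Ω η) : L2Vec Ω) : Plane → Plane) x = gradient (η : Plane → ℝ) x := h2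
    rw [h1, h3, norm_mul]
    refine mul_le_mul ((PiLp.norm_apply_le x 0).trans (hR x hx)) ?_ (norm_nonneg _)
      ((norm_nonneg x).trans (hR x hx))
    rw [← inner_gradient_left]
    exact (norm_inner_le_norm _ _).trans (by rw [he1, mul_one])
  have hsq : ‖val (testH1 Ω η)‖ ^ 2 = -(2 * inner ℝ (val (testH1 Ω η)) hm.toLp) := by
    rw [← real_inner_self_eq_norm_sq, L2.inner_def, L2.inner_def]
    have hl : ∫ x in (Ω : Set Plane), inner ℝ (val (testH1 Ω η) x) (val (testH1 Ω η) x) =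
        ∫ x, η x * η x := by
      rw [← setIntegral_eq_integral_of_forall_compl_eq_zero (s := (Ω : Set Plane))
        (f := fun x => η x * η x) (fun x hx => by simp [hη x hx])]
      refine integral_congr_ae ?_
      filter_upwards [hv] with x hx
      simp [hx, pow_two]
    have hr : ∫ x in (Ω : Set Plane), inner ℝ (val (testH1 Ω η) x) ((hm.toLp : L2 Ω) x) =
        ∫ x : Plane, η x * (x 0 * fderiv ℝ η x e) := by
      rw [← setIntegral_eq_integral_of_forall_compl_eq_zero (s := (Ω : Set Plane))
        (f := fun x : Plane => η x * (x 0 * fderiv ℝ η x e)) (fun x hx => by simp [hη x hx])]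
      refine integral_congr_ae ?_
      filter_upwards [hv, hm.coeFn_toLp] with x hx hx'
      simp [hx, hx', mul_comm]
    rw [hl, hr, integral_sq_eq_neg_two_mul]
  have hcs := abs_real_inner_le_norm (val (testH1 Ω η)) (hm.toLp : L2 Ω)
  have hn : ‖val (testH1 Ω η)‖ * ‖val (testH1 Ω η)‖ ≤
      (2 * R * ‖grad (testH1 Ω η)‖) * ‖val (testH1 Ω η)‖ := by
    have h1 := mul_le_mul_of_nonneg_left hle (norm_nonneg (val (testH1 Ω η)))
    have h2 := neg_abs_le (inner ℝ (val (testH1 Ω η)) (hm.toLp : L2 Ω))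
    linarith
  rcases (norm_nonneg (val (testH1 Ω η))).eq_or_lt with h0 | h0
  · rw [← h0]
    have := (norm_nonneg _).trans hle
    linarith
  · exact le_of_mul_le_mul_right hn h0

lemma testH1_add (η θ : 𝓓(Ω, ℝ)) : testH1 Ω (η + θ) = testH1 Ω η + testH1 Ω θ := by
  have h1 : (memLp_test Ω (η + θ)).toLp = (memLp_test Ω η).toLp + (memLp_test Ω θ).toLp := rfl
  have h2 : (memLp_gradient Ω (η + θ)).toLp =
      (memLp_gradient Ω η).toLp + (memLp_gradient Ω θ).toLp := by
    rw [← MemLp.toLp_add]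
    refine MemLp.toLp_congr _ _ (Filter.Eventually.of_forall fun x => ?_)
    have h := fderiv_add ((contDiff_infty Ω η).differentiable (by simp) x)
      ((contDiff_infty Ω θ).differentiable (by simp) x)
    exact (congrArg (InnerProductSpace.toDual ℝ Plane).symm h).trans (map_add _ _ _)
  exact Subtype.ext (congrArg (WithLp.toLp 2) (Prod.ext h1 h2))

lemma testH1_smul (c : ℝ) (η : 𝓓(Ω, ℝ)) : testH1 Ω (c • η) = c • testH1 Ω η := by
  have h1 : (memLp_test Ω (c • η)).toLp = c • (memLp_test Ω η).toLp := rfl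
  have h2 : (memLp_gradient Ω (c • η)).toLp = c • (memLp_gradient Ω η).toLp := by
    rw [← MemLp.toLp_const_smul]
    refine MemLp.toLp_congr _ _ (Filter.Eventually.of_forall fun x => ?_)
    have h := fderiv_const_smul ((contDiff_infty Ω η).differentiable (by simp) x) c
    refine (congrArg (InnerProductSpace.toDual ℝ Plane).symm h).trans ?_
    rw [map_smulₛₗ]
    rfl
  exact Subtype.ext (congrArg (WithLp.toLp 2) (Prod.ext h1 h2))

/-- The test functions form a linear subspace, so `H¹₀(Ω)` is the closure of the set of test
functions. -/
lemma coe_span_range_testH1 :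
    (Submodule.span ℝ (Set.range (testH1 Ω)) : Set (H1 Ω)) = Set.range (testH1 Ω) := by
  let T : 𝓓(Ω, ℝ) →ₗ[ℝ] H1 Ω :=
    { toFun := testH1 Ω
      map_add' := testH1_add
      map_smul' := testH1_smul }
  exact congrArg SetLike.coe (Submodule.span_eq (LinearMap.range T))

/-- The Poincaré inequality on `H¹₀(Ω)` for a bounded open set `Ω`. -/
lemma exists_norm_val_le_norm_grad (hΩ : Bornology.IsBounded (Ω : Set Plane)) :
    ∃ C : ℝ, ∀ v ∈ H10 Ω, ‖val v‖ ≤ C * ‖grad v‖ := by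
  obtain ⟨R, hR⟩ := hΩ.exists_norm_le
  refine ⟨2 * R, fun v hv => ?_⟩
  have hcl : IsClosed {w : H1 Ω | ‖val w‖ ≤ 2 * R * ‖grad w‖} :=
    isClosed_le val.continuous.norm (continuous_const.mul grad.continuous.norm)
  have hsub : (Submodule.span ℝ (Set.range (testH1 Ω)) : Set (H1 Ω)) ⊆
      {w : H1 Ω | ‖val w‖ ≤ 2 * R * ‖grad w‖} := by
    rw [coe_span_range_testH1]
    rintro _ ⟨η, rfl⟩
    exact norm_val_testH1_le hR η
  exact closure_minimal hsub hcl hv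

/-! ### The weak Poisson problem -/

/-- Since `grad v` is a weak gradient, `(∇v, ∇η)_Ω = -(v, Δη)_Ω` for test functions `η`. -/
lemma inner_grad_testH1 (v : H1 Ω) (η : 𝓓(Ω, ℝ)) :
    inner ℝ (grad v) (grad (testH1 Ω η)) =
      -inner ℝ (val v) (memLp_test Ω (lapTest η)).toLp := by
  have hg := (isWeakGradient_iff _ _).1 (isWeakGradient_grad v)
  let b := EuclideanSpace.basisFun (Fin 2) ℝ
  have e1 : (memLp_test Ω (lapTest η)).toLp =
      ∑ i, (memLp_test Ω (partialTest (partialTest η (b i)) (b i))).toLp := by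
    rw [Fin.sum_univ_two, ← MemLp.toLp_add]
    refine MemLp.toLp_congr _ _ (Filter.Eventually.of_forall fun x => ?_)
    simp only [lapTest, Fin.sum_univ_two]
    rfl
  have e2 : grad (testH1 Ω η) = ∑ i, (memLp_smul_test (partialTest η (b i)) (b i)).toLp := by
    change (memLp_gradient Ω η).toLp = _
    rw [Fin.sum_univ_two, ← MemLp.toLp_add]
    refine MemLp.toLp_congr _ _ (Filter.Eventually.of_forall fun x => ?_)
    have := b.sum_repr' (gradient (η : Plane → ℝ) x)
    rw [Fin.sum_univ_two, real_inner_comm, inner_gradient_left, real_inner_comm,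
      inner_gradient_left] at this
    exact this.symm
  rw [e1, e2, inner_sum, inner_sum, ← Finset.sum_neg_distrib]
  exact Finset.sum_congr rfl fun i _ => by rw [hg, neg_neg]

lemma testH1_mem_H10 (η : 𝓓(Ω, ℝ)) : testH1 Ω η ∈ H10 Ω :=
  Submodule.le_topologicalClosure _ (Submodule.subset_span ⟨η, rfl⟩)

lemma isWeakLaplacian_of_forall_inner_grad {v : H1 Ω} {φ : L2 Ω}
    (h : ∀ ψ ∈ H10 Ω, inner ℝ (grad v) (grad ψ) = inner ℝ φ (val ψ)) :
    IsWeakLaplacian (val v) (-φ) := by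
  rw [isWeakLaplacian_iff]
  intro η
  have h1 := h _ (testH1_mem_H10 η)
  rw [inner_grad_testH1] at h1
  rw [inner_neg_left, neg_eq_iff_eq_neg.1 h1]
  rfl

/-- The Lax–Milgram theorem for the form `(v, w) ↦ (T v, T w)` with `T` bounded below. -/
lemma exists_forall_inner_map_eq {H K : Type*} [NormedAddCommGroup H] [InnerProductSpace ℝ H]
    [CompleteSpace H] [NormedAddCommGroup K] [InnerProductSpace ℝ K] (T : H →L[ℝ] K) {c : ℝ}
    (hc : 0 < c) (hT : ∀ v, c * ‖v‖ ^ 2 ≤ ‖T v‖ ^ 2) (F : StrongDual ℝ H) :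
    ∃ v, ∀ w, inner ℝ (T v) (T w) = F w := by
  have hB : IsCoercive ((innerSL ℝ).bilinearComp T T) := by
    refine ⟨c, hc, fun v => ?_⟩
    rw [mul_assoc, ← pow_two]
    exact (hT v).trans_eq (real_inner_self_eq_norm_sq (T v)).symm
  obtain ⟨v, hv⟩ := hB.continuousLinearEquivOfBilin.surjective
    ((InnerProductSpace.toDual ℝ H).symm F)
  refine ⟨v, fun w => ?_⟩
  have h := hB.continuousLinearEquivOfBilin_apply v w
  rw [hv, InnerProductSpace.toDual_symm_apply] at h
  exact h.symm

/-- Existence for the weak Poisson problem, by the Lax–Milgram theorem. -/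
lemma exists_solvesPoisson (hΩ : Bornology.IsBounded (Ω : Set Plane)) (φ : L2 Ω) :
    ∃ v : V Ω, SolvesPoisson φ v := by
  obtain ⟨C, hC⟩ := exists_norm_val_le_norm_grad hΩ
  let T : H10 Ω →L[ℝ] L2Vec Ω := grad.comp (H10 Ω).subtypeL
  let F : StrongDual ℝ (H10 Ω) := (innerSL ℝ φ).comp (val.comp (H10 Ω).subtypeL)
  have hc : 0 < (C ^ 2 + 1)⁻¹ := by positivity
  have hT : ∀ v : H10 Ω, (C ^ 2 + 1)⁻¹ * ‖v‖ ^ 2 ≤ ‖T v‖ ^ 2 := by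
    intro v
    have h1 : ‖val (v : H1 Ω)‖ ^ 2 ≤ (C * ‖grad (v : H1 Ω)‖) ^ 2 :=
      pow_le_pow_left₀ (norm_nonneg _) (hC v v.2) 2
    have h2 : ‖v‖ ^ 2 = ‖val (v : H1 Ω)‖ ^ 2 + ‖grad (v : H1 Ω)‖ ^ 2 :=
      norm_sq_eq_val_add_grad (v : H1 Ω)
    rw [inv_mul_le_iff₀ (by positivity), h2]
    change _ ≤ _ * ‖grad (v : H1 Ω)‖ ^ 2
    linarith
  -- The instances on `H¹₀(Ω)` have to be found before `T` and `F` are unified with them.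
  have lax := exists_forall_inner_map_eq (H := H10 Ω) (K := L2Vec Ω)
  obtain ⟨v, hv⟩ := lax T hc hT F
  have h : ∀ ψ ∈ H10 Ω, inner ℝ (grad (v : H1 Ω)) (grad ψ) = inner ℝ φ (val ψ) :=
    fun ψ hψ => hv ⟨ψ, hψ⟩
  exact ⟨⟨v, v.2, -φ, isWeakLaplacian_of_forall_inner_grad h⟩, h⟩

lemma SolvesPoisson.eq_neg_lapV {φ : L2 Ω} {v : V Ω} (h : SolvesPoisson φ v) :
    φ = -lapV v := by
  rw [eq_neg_iff_add_eq_zero, add_comm, ← eq_neg_iff_add_eq_zero]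
  exact isWeakLaplacian_unique (isWeakLaplacian_lap (V.toH1Lap v))
    (isWeakLaplacian_of_forall_inner_grad h)

/-- A function in `V` solves the weak Poisson problem for `-Δv`, because `∂_n v` vanishes on the
trivial trace. -/
lemma solvesPoisson_neg_lapV (v : V Ω) : SolvesPoisson (-lapV v) v := by
  intro ψ hψ
  have h : inner ℝ (grad (v : H1 Ω)) (grad ψ) + inner ℝ (lapV v) (val ψ) = 0 :=
    H10_le_ker (V.toH1Lap v) hψ
  rw [inner_neg_left, eq_neg_of_add_eq_zero_left h]

lemma lapV_injective (hΩ : Bornology.IsBounded (Ω : Set Plane)) :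
    Function.Injective (lapV (Ω := Ω)) := by
  rw [← LinearMap.ker_eq_bot, LinearMap.ker_eq_bot']
  intro v hv
  obtain ⟨C, hC⟩ := exists_norm_val_le_norm_grad hΩ
  have h1 := solvesPoisson_neg_lapV v v v.2.1
  rw [hv, neg_zero, inner_zero_left, inner_self_eq_zero] at h1
  have h2 := hC v v.2.1
  rw [h1, norm_zero, mul_zero, norm_le_zero_iff] at h2
  have h3 := norm_sq_eq_val_add_grad (v : H1 Ω)
  rw [h1, h2] at h3
  simpa using h3

/-! ### The Green identity and the two formulations -/

theorem solvesPoisson_and_solvesGreen_iff (φ : L2 Ω) (v : V Ω) (ζ : VΓ Ω) :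
    (SolvesPoisson φ v ∧ SolvesGreen φ v ζ) ↔ (φ = -lapV v ∧ ζ = normalDerivV v) := by
  have hn : ∀ χ : H1 Ω, (normalDerivV v : StrongDual ℝ (TraceSpace Ω)) (trace χ) =
      inner ℝ (grad (v : H1 Ω)) (grad χ) + inner ℝ (lapV v) (val χ) :=
    normalDeriv_trace (V.toH1Lap v)
  have hsub : φ = -lapV v → ∀ χ : H1 Ω,
      inner ℝ (grad (v : H1 Ω)) (grad χ) - inner ℝ φ (val χ) =
        inner ℝ (grad (v : H1 Ω)) (grad χ) + inner ℝ (lapV v) (val χ) := by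
    rintro rfl χ
    rw [inner_neg_left]
    ring
  constructor
  · rintro ⟨hP, hG⟩
    have hφ := hP.eq_neg_lapV
    refine ⟨hφ, Subtype.ext (ContinuousLinearMap.ext fun x => ?_)⟩
    obtain ⟨χ, rfl⟩ : ∃ χ, trace χ = x := (H10 Ω).mkQ_surjective x
    by_cases hχ : χ ∈ H10 Ω
    · have h0 : trace χ = 0 := (Submodule.Quotient.mk_eq_zero _).2 hχ
      rw [h0, map_zero, map_zero]
    · exact (hG χ hχ).trans ((hsub hφ χ).trans (hn χ).symm)
  · rintro ⟨hφ, rfl⟩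
    exact ⟨hφ ▸ solvesPoisson_neg_lapV v, fun χ _ => (hn χ).trans (hsub hφ χ).symm⟩

theorem existsUnique_solution (hΩ : Bornology.IsBounded (Ω : Set Plane)) (φ : L2 Ω) :
    ∃! p : V Ω × VΓ Ω, SolvesPoisson φ p.1 ∧ SolvesGreen φ p.1 p.2 := by
  simp only [solvesPoisson_and_solvesGreen_iff]
  obtain ⟨v, hv⟩ := exists_solvesPoisson hΩ φ
  refine ⟨(v, normalDerivV v), ⟨hv.eq_neg_lapV, rfl⟩, ?_⟩
  rintro ⟨v', ζ'⟩ ⟨h1 : φ = -lapV v', h2 : ζ' = normalDerivV v'⟩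
  subst h2
  have h : v' = v := lapV_injective hΩ (neg_injective (h1.symm.trans hv.eq_neg_lapV))
  rw [h]

/-- The equivalence of the two formulations uses neither linearity nor boundedness of the data
`f` and `u`. -/
lemma forall_exists_solution_iff_forall_lapV (hΩ : Bornology.IsBounded (Ω : Set Plane))
    (f : V Ω → ℝ) (u : VΓ Ω → ℝ) (y : L2 Ω) :
    (∀ φ : L2 Ω, ∃ (v : V Ω) (ζ : VΓ Ω), SolvesPoisson φ v ∧ SolvesGreen φ v ζ ∧
      inner ℝ y φ = -u ζ + f v) ↔
    ∀ v : V Ω, inner ℝ y (lapV v) = u (normalDerivV v) - f v := by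
  constructor
  · intro h v
    obtain ⟨v', ζ, hP, hG, hy⟩ := h (-lapV v)
    obtain ⟨h1, rfl⟩ := (solvesPoisson_and_solvesGreen_iff (-lapV v) v' ζ).1 ⟨hP, hG⟩
    obtain rfl : v = v' := lapV_injective hΩ (neg_injective h1)
    rw [inner_neg_right] at hy
    linarith
  · intro h φ
    obtain ⟨v, hv⟩ := exists_solvesPoisson hΩ φ
    have hφ := hv.eq_neg_lapV
    obtain ⟨hP, hG⟩ := (solvesPoisson_and_solvesGreen_iff φ v (normalDerivV v)).2 ⟨hφ, rfl⟩
    refine ⟨v, normalDerivV v, hP, hG, ?_⟩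
    have hy : inner ℝ y φ = -inner ℝ y (lapV v) := by rw [hφ, inner_neg_right]
    exact hy.trans ((congrArg Neg.neg (h v)).trans (by ring))

theorem isBerggrenSolution_iff_isVeryWeakSolution (hΩ : Bornology.IsBounded (Ω : Set Plane))
    (f : DualV Ω) (u : DualVΓ Ω) (y : L2 Ω) :
    IsBerggrenSolution f u y ↔ IsVeryWeakSolution f u y :=
  forall_exists_solution_iff_forall_lapV hΩ f.1 u.1 y

end VeryWeak

theorem mainTheorem8 (Ω : TopologicalSpace.Opens VeryWeak.Plane)
    (hΩ : Bornology.IsBounded (Ω : Set VeryWeak.Plane)) :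
    (∀ φ : VeryWeak.L2 Ω, ∃! p : VeryWeak.V Ω × VeryWeak.VΓ Ω,
      VeryWeak.SolvesPoisson φ p.1 ∧ VeryWeak.SolvesGreen φ p.1 p.2) ∧
    (∀ (φ : VeryWeak.L2 Ω) (v : VeryWeak.V Ω) (ζ : VeryWeak.VΓ Ω),
      (VeryWeak.SolvesPoisson φ v ∧ VeryWeak.SolvesGreen φ v ζ) ↔
        (φ = -VeryWeak.lapV v ∧ ζ = VeryWeak.normalDerivV v)) ∧
    (∀ (f : VeryWeak.DualV Ω) (u : VeryWeak.DualVΓ Ω) (y : VeryWeak.L2 Ω),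
      VeryWeak.IsBerggrenSolution f u y ↔ VeryWeak.IsVeryWeakSolution f u y) := by
  exact ⟨VeryWeak.existsUnique_solution hΩ, VeryWeak.solvesPoisson_and_solvesGreen_iff,
    VeryWeak.isBerggrenSolution_iff_isVeryWeakSolution hΩ⟩
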